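/- Let $p,q$ be positive integers. In the (strict) $(p,q)$ Avoider-Enforcer game on a finite board $X$ with a family $\mathcal F$ of target subsets of $X$, two players, Avoider and Enforcer, alternately claim exactly $p$ and exactly $q$ previously unclaimed elements of $X$ per move, respectively; a player who at the beginning of his move finds fewer unclaimed elements than he has to claim claims all of them. The game ends when all of $X$ has been claimed; Avoider loses if he has then claimed all the elements of some target set, and otherwise he wins. For positive integers $b_1\le\dots\le b_n$, the misère box game $\mathrm{mBox}(b_1,\dots,b_n,(p,q))$ is this game with target sets $B_1,\dots,B_n$ that are pairwise disjoint, satisfy $|B_i|=b_i$ for all $i$, and have union $X$. **Theorem.** Let $p,q,k$ be positive integers such that $\gcd(p+q,\ell)\le p$ for every integer $1\le \ell\le k$. Then there exists a positive integer $N=N(p,q,k)$ such that for every integer $n\ge N$ and all positive integers $b_1\le b_2\le\dots\le b_n$ with $b_N\le k$, Enforcer has a winning strategy in the game $\mathrm{mBox}(b_1,\dots,b_n,(p,q))$, both when he is the first player and when he is the second player. -/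

import Mathlib

namespace AvoiderEnforcer

/-- The two players of an Avoider-Enforcer game. -/
inductive Player where
  | avoider
  | enforcer

section Game

variable {X : Type*} [Fintype X] [DecidableEq X]

/-- The unclaimed elements of the board `X` when Avoider has claimed `A` and Enforcer has
claimed `E`. -/
def unclaimed (A E : Finset X) : Finset X := Finset.univ \ (A ∪ E)

/-- Strict rules: a move with bias `r` in the position `(A, E)` claims a set `M` of exactly `r`
unclaimed elements, or all the unclaimed elements if there are fewer than `r` of them. -/
def IsMove (r : ℕ) (A E M : Finset X) : Prop :=
  M ⊆ unclaimed A E ∧ M.card = min r (unclaimed A E).card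

variable (X) in
/-- A strategy of Enforcer with bias `q`: it assigns a legal move to every position `(A, E)`. -/
structure EnforcerStrategy (q : ℕ) where
  move : Finset X → Finset X → Finset X
  legal : ∀ A E : Finset X, Disjoint A E → IsMove q A E (move A E)

/-- `Reachable p q σ first turn A E`: in the strict `(p, q)` game begun by the player `first`,
some sequence of legal moves of Avoider, against Enforcer playing according to `σ`, leads to
the position in which Avoider has claimed `A`, Enforcer has claimed `E`, and `turn` is to move. -/
inductive Reachable (p q : ℕ) (σ : EnforcerStrategy X q) (first : Player) :
    Player → Finset X → Finset X → Prop
  | start : Reachable p q σ first first ∅ ∅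
  | avoider_move {A E M : Finset X} (h : Reachable p q σ first Player.avoider A E)
      (hM : IsMove p A E M) : Reachable p q σ first Player.enforcer (A ∪ M) E
  | enforcer_move {A E : Finset X} (h : Reachable p q σ first Player.enforcer A E) :
      Reachable p q σ first Player.avoider A (E ∪ σ.move A E)

/-- Enforcer has a winning strategy in the strict `(p, q)` Avoider-Enforcer game on the board `X`
with target sets `F` begun by `first`: he has a strategy such that whenever a play against it has
ended (the whole board has been claimed), Avoider has claimed all the elements of a target set. -/
def EnforcerHasWinningStrategy (p q : ℕ) (F : Set (Finset X)) (first : Player) : Prop :=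
  ∃ σ : EnforcerStrategy X q, ∀ (turn : Player) (A E : Finset X),
    Reachable p q σ first turn A E → A ∪ E = Finset.univ → ∃ T ∈ F, T ⊆ A

/-- `B` is a family of pairwise disjoint boxes of sizes `b 0, …, b (n - 1)` whose union is the
whole board `X`; the game with target sets `Set.range B` is then the misère box game
`mBox (b_1, …, b_n, (p, q))`, where `b_i` is `b (i - 1)`. -/
structure IsBoxFamily {n : ℕ} (b : Fin n → ℕ) (B : Fin n → Finset X) : Prop where
  card_eq : ∀ i, (B i).card = b i
  disjoint : ∀ i j, i ≠ j → Disjoint (B i) (B j)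
  cover : ∀ x : X, ∃ i, x ∈ B i

end Game

end AvoiderEnforcer

/-! Induction on `k`: enough boxes untouched by Enforcer, each with at most `k` free elements, give
Enforcer the win (`Suffices`). For `k + 1`, Enforcer always plays outside a set `S` of such boxes.
If too little is free there, he gives up boxes with exactly `k + 1` free elements, which leaves the
number of outside elements unchanged modulo `k + 1`. So while Avoider also plays outside, each round
subtracts `p + q` from that residue. As `gcd (p + q) (k + 1) ≤ p`, within boundedly many rounds
fewer than `p` elements are left outside (`exists_rounds`), and Avoider must play inside `S`,
raising the deficit (`avoider_move_dichotomy`). Once the deficit reaches `(k + 1) * N`, at least `N`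
boxes have at most `k` free elements, and induction applies. -/

namespace AvoiderEnforcer

/-! ### Forced wins and strategies -/

section Forcing

variable {X : Type*} [Fintype X] [DecidableEq X]

/-- Enforcer can force Avoider to claim a member of `F` from the position `(A, E)` in which
the given player is to move. -/
inductive ForcesWin (p q : ℕ) (F : Set (Finset X)) : Player → Finset X → Finset X → Prop
  | claimed {t : Player} {A E : Finset X} (h : ∃ T ∈ F, T ⊆ A) : ForcesWin p q F t A E
  | avoider_turn {A E : Finset X}
      (h : ∀ M, IsMove p A E M → ForcesWin p q F Player.enforcer (A ∪ M) E) :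
      ForcesWin p q F Player.avoider A E
  | enforcer_turn {A E M : Finset X} (hM : IsMove q A E M)
      (h : ForcesWin p q F Player.avoider A (E ∪ M)) : ForcesWin p q F Player.enforcer A E

theorem exists_isMove (r : ℕ) (A E : Finset X) : ∃ M, IsMove r A E M := by
  obtain ⟨M, hM, hc⟩ := Finset.exists_subset_card_eq (s := unclaimed A E)
    (n := min r (unclaimed A E).card) (min_le_right _ _)
  exact ⟨M, hM, hc⟩

theorem IsMove.eq_empty_of_full {r : ℕ} {A E M : Finset X} (hM : IsMove r A E M)
    (h : A ∪ E = Finset.univ) : M = ∅ := by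
  have := hM.1
  rw [unclaimed, h, Finset.sdiff_self] at this
  exact Finset.subset_empty.1 this

theorem IsMove.disjoint_left {r : ℕ} {A E M : Finset X} (hM : IsMove r A E M) :
    Disjoint M A :=
  Finset.disjoint_left.2 fun x hx hA => by
    have := hM.1 hx
    simp [unclaimed, hA] at this

/-- On a full board every legal move is empty, so unfolding the forced win never changes the
position. -/
theorem ForcesWin.claimed_of_full {p q : ℕ} {F : Set (Finset X)} {t : Player} {A E : Finset X}
    (h : ForcesWin p q F t A E) (hfull : A ∪ E = Finset.univ) : ∃ T ∈ F, T ⊆ A := by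
  induction h with
  | claimed h => exact h
  | @avoider_turn A E h ih =>
    obtain ⟨M, hM⟩ := exists_isMove p A E
    have he := hM.eq_empty_of_full hfull
    have := ih M hM
    rw [he, Finset.union_empty] at this
    exact this hfull
  | @enforcer_turn A E M hM h ih =>
    apply ih
    rw [hM.eq_empty_of_full hfull, Finset.union_empty, hfull]

-- Choosing a move that keeps the win forced makes `ForcesWin` an invariant of play. The default
-- branch only makes the strategy total.
open Classical in
theorem ForcesWin.hasWinningStrategy {p q : ℕ} {F : Set (Finset X)} {first : Player}
    (h : ForcesWin p q F first ∅ ∅) : EnforcerHasWinningStrategy p q F first := by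
  let σ : EnforcerStrategy X q :=
    { move := fun A E =>
        if h : ∃ M, IsMove q A E M ∧ ForcesWin p q F Player.avoider A (E ∪ M) then h.choose
        else (exists_isMove q A E).choose
      legal := fun A E _ => by
        split_ifs with h
        · exact h.choose_spec.1
        · exact (exists_isMove q A E).choose_spec }
  have key : ∀ t A E, Reachable p q σ first t A E → ForcesWin p q F t A E := by
    intro t A E hr
    induction hr with
    | start => exact h
    | avoider_move _ hM ih =>
      cases ih with
      | claimed h =>
        obtain ⟨T, hT, hTA⟩ := h
        exact .claimed ⟨T, hT, hTA.trans Finset.subset_union_left⟩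
      | avoider_turn h => exact h _ hM
    | @enforcer_move A E _ ih =>
      cases ih with
      | claimed h => exact .claimed h
      | enforcer_turn hM h =>
        have hex : ∃ M, IsMove q A E M ∧ ForcesWin p q F Player.avoider A (E ∪ M) := ⟨_, hM, h⟩
        have : σ.move A E = hex.choose := dif_pos hex
        rw [this]
        exact hex.choose_spec.2
  exact ⟨σ, fun t A E hr hfull => (key t A E hr).claimed_of_full hfull⟩

end Forcing

/-! ### Counting in the boxes and single moves -/

section Boxes

set_option linter.unusedSectionVars false

variable {X : Type*} [Fintype X] [DecidableEq X] {ι : Type*} [DecidableEq ι]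

/-- The unclaimed elements outside the boxes with index in `S`. -/
def outside (B : ι → Finset X) (S : Finset ι) (A E : Finset X) : Finset X :=
  unclaimed A E \ S.biUnion B

/-- The boxes with index in `S` are untouched by Enforcer and have at most `k` elements
not claimed by Avoider. -/
def Live (B : ι → Finset X) (k : ℕ) (S : Finset ι) (A E : Finset X) : Prop :=
  ∀ i ∈ S, Disjoint (B i) E ∧ (B i \ A).card ≤ k

/-- The number of elements missing for the boxes with index in `S` to have `k` elements not
claimed by Avoider each. -/
def deficit (B : ι → Finset X) (k : ℕ) (S : Finset ι) (A : Finset X) : ℕ :=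
  ∑ i ∈ S, (k - (B i \ A).card)

theorem Live.mono {B : ι → Finset X} {k : ℕ} {S : Finset ι} {A A' E : Finset X}
    (h : Live B k S A E) (hA : A ⊆ A') : Live B k S A' E := fun i hi =>
  ⟨(h i hi).1, (Finset.card_le_card (Finset.sdiff_subset_sdiff subset_rfl hA)).trans (h i hi).2⟩

theorem deficit_mono {B : ι → Finset X} {k : ℕ} {S : Finset ι} {A A' : Finset X}
    (hA : A ⊆ A') : deficit B k S A ≤ deficit B k S A' :=
  Finset.sum_le_sum fun _ _ => Nat.sub_le_sub_left
    (Finset.card_le_card (Finset.sdiff_subset_sdiff subset_rfl hA)) k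

/-- The boxes of `S` with fewer than `k` elements not claimed by Avoider. -/
def touched (B : ι → Finset X) (k : ℕ) (S : Finset ι) (A : Finset X) : Finset ι :=
  S.filter fun i => (B i \ A).card < k

theorem deficit_le (B : ι → Finset X) (k : ℕ) (S : Finset ι) (A : Finset X) :
    deficit B k S A ≤ k * (touched B k S A).card := by
  have h : deficit B k S A = ∑ i ∈ touched B k S A, (k - (B i \ A).card) := by
    rw [deficit, touched]
    refine (Finset.sum_filter_of_ne ?_).symm
    intro i _ hi
    omega
  rw [h, mul_comm, ← smul_eq_mul]
  exact Finset.sum_le_card_nsmul _ _ _ fun i _ => Nat.sub_le _ _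

/-- Avoider either plays `p` elements outside the boxes of `S` or increases their deficit. -/
theorem avoider_move_dichotomy {p k : ℕ} {B : ι → Finset X} {S : Finset ι} {A E M : Finset X}
    (hk : 0 < k) (hlive : Live B k S A E) (hU : ∃ i ∈ S, (B i \ A).card = k)
    (hM : IsMove p A E M) :
    (outside B S (A ∪ M) E).card + p = (outside B S A E).card ∨
      deficit B k S A + 1 ≤ deficit B k S (A ∪ M) := by
  by_cases hsub : M ⊆ outside B S A E
  · left
    have hout : outside B S (A ∪ M) E = outside B S A E \ M := by
      ext x
      simp only [outside, unclaimed, Finset.mem_sdiff, Finset.mem_union, Finset.mem_univ]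
      tauto
    have hcard := Finset.card_sdiff_add_card_eq_card hsub
    -- A free element remains inside `S`, so `M` cannot be a truncated last move and has exactly `p`
    -- elements.
    have hlt : (outside B S A E).card < (unclaimed A E).card := by
      obtain ⟨i, hi, hik⟩ := hU
      obtain ⟨x, hx⟩ := Finset.card_pos.1 (hik ▸ hk)
      rw [Finset.mem_sdiff] at hx
      have hxE := Finset.disjoint_left.1 (hlive i hi).1 hx.1
      refine Finset.card_lt_card ⟨Finset.sdiff_subset, fun hss => ?_⟩
      have hxu : x ∈ unclaimed A E := by simp [unclaimed, hx.2, hxE]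
      exact (Finset.mem_sdiff.1 (hss hxu)).2 (Finset.mem_biUnion.2 ⟨i, hi, hx.1⟩)
    have := hM.2
    have := Finset.card_le_card hsub
    rw [hout]
    omega
  · right
    obtain ⟨x, hxM, hx⟩ := Finset.not_subset.1 hsub
    have hxu := hM.1 hxM
    have hxB : x ∈ S.biUnion B := by
      by_contra h
      exact hx (Finset.mem_sdiff.2 ⟨hxu, h⟩)
    obtain ⟨i, hi, hxi⟩ := Finset.mem_biUnion.1 hxB
    refine Finset.sum_lt_sum (fun j _ => Nat.sub_le_sub_left (Finset.card_le_card
      (Finset.sdiff_subset_sdiff subset_rfl Finset.subset_union_left)) k) ⟨i, hi, ?_⟩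
    have hlt : (B i \ (A ∪ M)).card < (B i \ A).card := by
      refine Finset.card_lt_card ⟨Finset.sdiff_subset_sdiff subset_rfl Finset.subset_union_left,
        fun hss => ?_⟩
      have hxA : x ∈ B i \ A := Finset.mem_sdiff.2
        ⟨hxi, fun h => Finset.disjoint_left.1 hM.disjoint_left hxM h⟩
      exact (Finset.mem_sdiff.1 (hss hxA)).2 (Finset.mem_union_right _ hxM)
    have := (hlive i hi).2
    omega

/-- Enforcer can play outside the boxes of `S`, giving up `t ≤ q` of them that have exactly `k`
unclaimed elements, and none unless he has to. -/
theorem exists_enforcer_move {q k : ℕ} {B : ι → Finset X} {S : Finset ι} {A E : Finset X}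
    (hB : ∀ i j, i ≠ j → Disjoint (B i) (B j)) (hk : 0 < k) (hlive : Live B k S A E)
    (hU : (touched B k S A).card + q ≤ S.card) :
    ∃ (M : Finset X) (S' : Finset ι) (t : ℕ), IsMove q A E M ∧ Live B k S' A (E ∪ M) ∧
      deficit B k S' A = deficit B k S A ∧ S.card ≤ S'.card + q ∧
      (outside B S' A (E ∪ M)).card + q = (outside B S A E).card + k * t ∧
      ((outside B S' A (E ∪ M)).card < k ∨ S' = S ∧ t = 0) := by
  -- `t` is the ceiling of `(q - g) / k`, `g` being the outside count; by minimality fewer than `k`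
  -- elements remain outside when `t` is positive.
  obtain ⟨t, htq, htg, ht⟩ : ∃ t ≤ q, q ≤ (outside B S A E).card + k * t ∧
      ((outside B S A E).card + k * t < k + q ∨ t = 0) := by
    generalize (outside B S A E).card = g
    by_cases h : q ≤ g
    · exact ⟨0, by omega, by omega, by omega⟩
    · have h1 := Nat.div_add_mod (q - g + k - 1) k
      have h2 := Nat.mod_lt (q - g + k - 1) hk
      refine ⟨(q - g + k - 1) / k, ?_, by omega, by omega⟩
      apply Nat.le_of_lt_succ
      rw [Nat.div_lt_iff_lt_mul hk]
      have : q ≤ q * k := Nat.le_mul_of_pos_right _ hk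
      rw [Nat.succ_mul]
      omega
  have hfilter := Finset.card_sdiff_add_card_eq_card
    (show touched B k S A ⊆ S from Finset.filter_subset _ _)
  obtain ⟨V, hVsub, hVcard⟩ := Finset.exists_subset_card_eq (s := S \ touched B k S A) (n := t)
    (by omega)
  have hVS : V ⊆ S := hVsub.trans Finset.sdiff_subset
  have hVk : ∀ i ∈ V, (B i \ A).card = k := by
    intro i hi
    have h1 := Finset.mem_sdiff.1 (hVsub hi)
    have h2 := (hlive i h1.1).2
    have h3 : ¬ (B i \ A).card < k := fun h => h1.2 (Finset.mem_filter.2 ⟨h1.1, h⟩)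
    omega
  have hout : outside B (S \ V) A E = outside B S A E ∪ V.biUnion fun i => B i \ A := by
    ext x
    simp only [outside, unclaimed, Finset.mem_sdiff, Finset.mem_union, Finset.mem_univ,
      Finset.mem_biUnion, true_and, not_exists, not_and]
    constructor
    · rintro ⟨hx, hS⟩
      by_cases h : ∃ i ∈ V, x ∈ B i
      · obtain ⟨i, hi, hxi⟩ := h
        exact Or.inr ⟨i, hi, hxi, fun h => hx (Or.inl h)⟩
      · refine Or.inl ⟨hx, fun i hi hxi => hS i ⟨hi, fun hV => h ⟨i, hV, hxi⟩⟩ hxi⟩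
    · rintro (⟨hx, hS⟩ | ⟨i, hi, hxi, hxA⟩)
      · exact ⟨hx, fun i hi => hS i hi.1⟩
      · refine ⟨?_, ?_⟩
        · rintro (h | h)
          · exact hxA h
          · exact Finset.disjoint_left.1 (hlive i (hVS hi)).1 hxi h
        · rintro j ⟨_, hjV⟩ hxj
          have hne : i ≠ j := fun h => hjV (h ▸ hi)
          exact Finset.disjoint_left.1 (hB i j hne) hxi hxj
  have hcard : (outside B (S \ V) A E).card = (outside B S A E).card + k * t := by
    rw [hout, Finset.card_union_of_disjoint, Finset.card_biUnion, Finset.sum_congr rfl hVk,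
      Finset.sum_const, hVcard, smul_eq_mul, mul_comm]
    · intro i _ j _ hij
      exact (hB i j hij).mono Finset.sdiff_subset Finset.sdiff_subset
    · refine Finset.disjoint_left.2 fun x hx hxV => ?_
      obtain ⟨i, hi, hxi⟩ := Finset.mem_biUnion.1 hxV
      exact (Finset.mem_sdiff.1 hx).2
        (Finset.mem_biUnion.2 ⟨i, hVS hi, (Finset.mem_sdiff.1 hxi).1⟩)
  obtain ⟨M, hMsub, hMcard⟩ := Finset.exists_subset_card_eq (s := outside B (S \ V) A E) (n := q)
    (by omega)
  have hMu : M ⊆ unclaimed A E := hMsub.trans Finset.sdiff_subset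
  have hout' : outside B (S \ V) A (E ∪ M) = outside B (S \ V) A E \ M := by
    ext x
    simp only [outside, unclaimed, Finset.mem_sdiff, Finset.mem_union, Finset.mem_univ]
    tauto
  have hcard' := Finset.card_sdiff_add_card_eq_card hMsub
  have hSV := Finset.card_sdiff_add_card_eq_card hVS
  refine ⟨M, S \ V, t, ⟨hMu, ?_⟩, ?_, ?_, by omega, ?_, ?_⟩
  · have := Finset.card_le_card hMu
    omega
  · intro i hi
    have hiS := (Finset.mem_sdiff.1 hi).1
    refine ⟨Finset.disjoint_union_right.2 ⟨(hlive i hiS).1, ?_⟩, (hlive i hiS).2⟩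
    refine Finset.disjoint_left.2 fun x hx hxM => ?_
    exact (Finset.mem_sdiff.1 (hMsub hxM)).2 (Finset.mem_biUnion.2 ⟨i, hi, hx⟩)
  · rw [deficit, deficit, ← Finset.sum_sdiff hVS, Finset.sum_eq_zero (s := V), add_zero]
    intro i hi
    rw [hVk i hi, Nat.sub_self]
  · rw [hout']
    omega
  · rw [hout']
    rcases ht with h | h
    · left; omega
    · right
      rw [h, Finset.card_eq_zero] at hVcard
      exact ⟨by rw [hVcard, Finset.sdiff_empty], h⟩

/-! ### The induction on the box size -/

/-- `N` live boxes with at most `k` free elements suffice for Enforcer. -/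
def Suffices (p q : ℕ) (B : ι → Finset X) (k N : ℕ) : Prop :=
  ∀ (S : Finset ι) (A E : Finset X) (t : Player), N ≤ S.card → Live B k S A E →
    ForcesWin p q (Set.range B) t A E

theorem suffices_zero (p q : ℕ) (B : ι → Finset X) : Suffices p q B 0 1 := by
  intro S A E t hS hlive
  obtain ⟨i, hi⟩ := Finset.card_pos.1 hS
  refine .claimed ⟨B i, ⟨i, rfl⟩, ?_⟩
  have := (hlive i hi).2
  rwa [Nat.le_zero, Finset.card_eq_zero, Finset.sdiff_eq_empty_iff_subset] at this

theorem Suffices.of_touched {p q k N : ℕ} {B : ι → Finset X} (h : Suffices p q B k N)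
    {S : Finset ι} {A E : Finset X} {t : Player} (hlive : Live B (k + 1) S A E)
    (hN : N ≤ (touched B (k + 1) S A).card) : ForcesWin p q (Set.range B) t A E := by
  refine h _ A E t hN fun i hi => ?_
  have hi := Finset.mem_filter.1 hi
  exact ⟨(hlive i hi.1).1, Nat.le_of_lt_succ hi.2⟩

/-- Subtracting `s` repeatedly from `g` modulo `k` leads to a residue below `gcd s k`. -/
theorem exists_rounds {s k p : ℕ} (hk : 0 < k) (hgcd : Nat.gcd s k ≤ p) (g : ℕ) :
    ∃ r ≤ k, ∃ z < p, z + r * s ≡ g [MOD k] := by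
  have hd : 0 < Nat.gcd s k := Nat.gcd_pos_of_pos_right _ hk
  have hk' : (0 : ℤ) < k := by exact_mod_cast hk
  -- By Bézout, `c * s` is congruent to `g - g % gcd s k`; hence the witness `z = g % gcd s k`.
  set c : ℤ := Nat.gcdA s k * ((g / Nat.gcd s k : ℕ) : ℤ) with hc
  have h0 := Int.emod_nonneg c hk'.ne'
  have h1 := Int.emod_lt_of_pos c hk'
  refine ⟨(c % k).toNat, by omega, g % Nat.gcd s k, (Nat.mod_lt _ hd).trans_le hgcd, ?_⟩
  rw [← Int.natCast_modEq_iff]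
  push_cast
  rw [Int.toNat_of_nonneg h0]
  have hg : (g : ℤ) = g % (Nat.gcd s k : ℕ) + (Nat.gcd s k : ℕ) * ((g / Nat.gcd s k : ℕ) : ℤ) := by
    exact_mod_cast (Nat.mod_add_div g (Nat.gcd s k)).symm
  have hb := Nat.gcd_eq_gcd_ab s k
  calc ((g : ℤ) % (Nat.gcd s k : ℕ) + c % k * s) ≡ g % (Nat.gcd s k : ℕ) + c * s [ZMOD k] :=
        Int.ModEq.add_left _ ((Int.mod_modEq c k).mul_right _)
    _ ≡ g [ZMOD k] := by
        refine (Int.modEq_iff_dvd).2 ⟨Nat.gcdB s k * ((g / Nat.gcd s k : ℕ) : ℤ), ?_⟩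
        rw [hc]
        linear_combination hg + ((g / Nat.gcd s k : ℕ) : ℤ) * hb

/-- With fewer than `N` touched boxes, at least `q` untouched ones can be given up. -/
theorem Suffices.forcesWin_enforcer {p q k N : ℕ} {B : ι → Finset X}
    (h : Suffices p q B k N) (hB : ∀ i j, i ≠ j → Disjoint (B i) (B j))
    {S : Finset ι} {A E : Finset X} (hlive : Live B (k + 1) S A E) (hS : N + q ≤ S.card)
    (hnext : ∀ (E' : Finset X) (S' : Finset ι) (t : ℕ), Live B (k + 1) S' A E' →
      deficit B (k + 1) S' A = deficit B (k + 1) S A → S.card ≤ S'.card + q →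
      (outside B S' A E').card + q = (outside B S A E).card + (k + 1) * t →
      ((outside B S' A E').card < k + 1 ∨ S' = S ∧ t = 0) →
      ForcesWin p q (Set.range B) Player.avoider A E') :
    ForcesWin p q (Set.range B) Player.enforcer A E := by
  by_cases hT : N ≤ (touched B (k + 1) S A).card
  · exact h.of_touched hlive hT
  obtain ⟨M, S', t, hM, h1, h2, h3, h4, h5⟩ :=
    exists_enforcer_move (q := q) (k := k + 1) hB (Nat.succ_pos k) hlive (by omega)
  exact .enforcer_turn hM (hnext _ S' t h1 h2 h3 h4 h5)

theorem Suffices.forcesWin_avoider {p q k N : ℕ} {B : ι → Finset X}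
    (h : Suffices p q B k N) (hq : 0 < q)
    {S : Finset ι} {A E : Finset X} (hlive : Live B (k + 1) S A E) (hS : N + q ≤ S.card)
    (hnext : ∀ A' : Finset X, Live B (k + 1) S A' E →
      deficit B (k + 1) S A ≤ deficit B (k + 1) S A' →
      (outside B S A' E).card ≤ (outside B S A E).card →
      ((outside B S A' E).card + p = (outside B S A E).card ∨
        deficit B (k + 1) S A + 1 ≤ deficit B (k + 1) S A') →
      ForcesWin p q (Set.range B) Player.enforcer A' E) :
    ForcesWin p q (Set.range B) Player.avoider A E := by
  by_cases hT : N ≤ (touched B (k + 1) S A).card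
  · exact h.of_touched hlive hT
  have hU : ∃ i ∈ S, (B i \ A).card = k + 1 := by
    by_contra! hne
    have : touched B (k + 1) S A = S := Finset.filter_true_of_mem fun i hi =>
      lt_of_le_of_ne (hlive i hi).2 (hne i hi)
    rw [this] at hT
    omega
  refine .avoider_turn fun M hM => hnext _ (hlive.mono Finset.subset_union_left)
    (deficit_mono Finset.subset_union_left) (Finset.card_le_card ?_)
    (avoider_move_dichotomy (Nat.succ_pos k) hlive hU hM)
  refine Finset.sdiff_subset_sdiff (Finset.sdiff_subset_sdiff subset_rfl ?_) subset_rfl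
  exact Finset.union_subset_union_left Finset.subset_union_left

/-- Few unclaimed elements are left outside the boxes; `r` bounds the number of rounds until
Avoider has to play in the boxes, and `m` how often he has to do so. -/
theorem Suffices.forcesWin_of_outside_lt {p q k N : ℕ} {B : ι → Finset X}
    (h : Suffices p q B k N) (hB : ∀ i j, i ≠ j → Disjoint (B i) (B j))
    (hgcd : Nat.gcd (p + q) (k + 1) ≤ p) (hq : 0 < q) (m : ℕ) :
    ∀ (r : ℕ) (S : Finset ι) (A E : Finset X), Live B (k + 1) S A E →
      N + q * (m * (k + 2) + r) ≤ S.card → (k + 1) * N ≤ deficit B (k + 1) S A + m →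
      (outside B S A E).card < k + 1 →
      (∃ z < p, z + r * (p + q) ≡ (outside B S A E).card [MOD k + 1]) →
      ForcesWin p q (Set.range B) Player.avoider A E := by
  induction m with
  | zero =>
    intro r S A E hlive hS hdef hg hz
    refine h.of_touched hlive ?_
    exact Nat.le_of_mul_le_mul_left (hdef.trans (deficit_le B (k + 1) S A)) (Nat.succ_pos k)
  | succ m ihm =>
    intro r
    induction r using Nat.strongRecOn with
    | ind r ihr =>
    intro S A E hlive hS hdef hg hz
    -- Boxes for the `m` later phases of at most `k + 2` rounds, then for this round, then for the
    -- `r` rounds left.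
    have hS' : N + q * (m * (k + 2) + (k + 1)) + q + q * r ≤ S.card := by
      refine le_trans (le_of_eq ?_) hS
      ring
    have hSq : N + q ≤ S.card := by
      have := Nat.zero_le (q * (m * (k + 2) + (k + 1)))
      have := Nat.zero_le (q * r)
      omega
    refine h.forcesWin_avoider hq hlive hSq fun A' hlive' hdef' hout' hmove => ?_
    refine h.forcesWin_enforcer hB hlive' hSq fun E' S' t hlive'' hdef'' hcard hout'' ht => ?_
    have hlt : (outside B S' A' E').card < k + 1 := by
      rcases ht with ht | ⟨_, rfl⟩
      · exact ht
      · rw [mul_zero] at hout''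
        omega
    rcases hmove with hmove | hmove
    · obtain ⟨z, hzp, hz⟩ := hz
      obtain _ | r := r
      -- The outside count is now `z % (k + 1) < p`, so Avoider could not have played `p` elements
      -- there.
      · have := Nat.mod_le z (k + 1)
        rw [zero_mul, add_zero, Nat.ModEq, Nat.mod_eq_of_lt hg] at hz
        omega
      · refine ihr r (Nat.lt_succ_self r) S' A' E' hlive'' ?_ (by omega) hlt ⟨z, hzp, ?_⟩
        · have : q * ((m + 1) * (k + 2) + (r + 1)) = q * ((m + 1) * (k + 2) + r) + q := by ring
          omega
        · have h1 : (outside B S' A' E').card + (p + q) =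
              (outside B S A E).card + (k + 1) * t := by omega
          refine Nat.ModEq.add_right_cancel' (p + q) ?_
          rw [h1, add_assoc, ← Nat.succ_mul]
          refine hz.trans ?_
          simp [Nat.ModEq]
    -- The deficit grew: a new phase starts from the current residue.
    · obtain ⟨r', hr', hz'⟩ := exists_rounds (Nat.succ_pos k) hgcd (outside B S' A' E').card
      refine ihm r' S' A' E' hlive'' ?_ (by omega) hlt hz'
      have : q * (m * (k + 2) + r') ≤ q * (m * (k + 2) + (k + 1)) :=
        Nat.mul_le_mul_left _ (Nat.add_le_add_left hr' _)
      omega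

/-- Enforcer plays outside the boxes until few unclaimed elements are left there. -/
theorem Suffices.forcesWin_enforcer_of_card {p q k N : ℕ} {B : ι → Finset X}
    (h : Suffices p q B k N) (hB : ∀ i j, i ≠ j → Disjoint (B i) (B j))
    (hgcd : Nat.gcd (p + q) (k + 1) ≤ p) (hq : 0 < q) (g : ℕ) :
    ∀ (S : Finset ι) (A E : Finset X), Live B (k + 1) S A E →
      N + q * ((k + 1) * N * (k + 2) + (k + 1)) + q ≤ S.card → (outside B S A E).card = g →
      ForcesWin p q (Set.range B) Player.enforcer A E := by
  induction g using Nat.strongRecOn with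
  | ind g ih =>
  intro S A E hlive hS hg
  refine h.forcesWin_enforcer hB hlive (by omega) fun E' S' t hlive' hdef hcard hout ht => ?_
  by_cases hlt : (outside B S' A E').card < k + 1
  · obtain ⟨r, hr, hz⟩ := exists_rounds (Nat.succ_pos k) hgcd (outside B S' A E').card
    refine h.forcesWin_of_outside_lt hB hgcd hq ((k + 1) * N) r S' A E' hlive' ?_ (by omega)
      hlt hz
    have : q * ((k + 1) * N * (k + 2) + r) ≤ q * ((k + 1) * N * (k + 2) + (k + 1)) :=
      Nat.mul_le_mul_left _ (Nat.add_le_add_left hr _)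
    omega
  -- No box was given up, so the outside count drops by `q > 0`.
  · obtain ⟨rfl, rfl⟩ := ht.resolve_left hlt
    refine h.forcesWin_avoider hq hlive' (by omega) fun A' hlive'' _ hout' _ => ?_
    exact ih _ (by omega) S' A' E' hlive'' hS rfl

theorem Suffices.succ {p q k N : ℕ} {B : ι → Finset X}
    (h : Suffices p q B k N) (hB : ∀ i j, i ≠ j → Disjoint (B i) (B j))
    (hgcd : Nat.gcd (p + q) (k + 1) ≤ p) (hq : 0 < q) :
    Suffices p q B (k + 1) (N + q * ((k + 1) * N * (k + 2) + (k + 1)) + q) := by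
  intro S A E t hS hlive
  cases t with
  | enforcer => exact h.forcesWin_enforcer_of_card hB hgcd hq _ S A E hlive hS rfl
  | avoider =>
    exact h.forcesWin_avoider hq hlive (by omega) fun A' hlive' _ _ _ =>
      h.forcesWin_enforcer_of_card hB hgcd hq _ S A' E hlive' hS rfl

/-- A number of boxes of size at most `k` with which Enforcer wins. -/
def sufficientCount (q : ℕ) : ℕ → ℕ
  | 0 => 1
  | k + 1 => sufficientCount q k +
      q * ((k + 1) * sufficientCount q k * (k + 2) + (k + 1)) + q

theorem sufficientCount_pos (q k : ℕ) : 0 < sufficientCount q k := by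
  induction k with
  | zero => exact Nat.one_pos
  | succ k ih => rw [sufficientCount]; omega

theorem suffices_sufficientCount {p q k : ℕ} {B : ι → Finset X} (hq : 0 < q)
    (hgcd : ∀ ℓ : ℕ, 1 ≤ ℓ → ℓ ≤ k → Nat.gcd (p + q) ℓ ≤ p)
    (hB : ∀ i j, i ≠ j → Disjoint (B i) (B j)) : Suffices p q B k (sufficientCount q k) := by
  induction k with
  | zero => exact suffices_zero p q B
  | succ k ih =>
    exact (ih fun ℓ h1 h2 => hgcd ℓ h1 (by omega)).succ hB (hgcd _ (by omega) le_rfl) hq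

end Boxes

end AvoiderEnforcer

theorem theorem1p3 (p q k : ℕ) (hp : 0 < p) (hq : 0 < q) (hk : 0 < k)
    (hgcd : ∀ ℓ : ℕ, 1 ≤ ℓ → ℓ ≤ k → Nat.gcd (p + q) ℓ ≤ p) :
    ∃ (N : ℕ) (hN : 0 < N), ∀ (n : ℕ) (hn : N ≤ n) (b : Fin n → ℕ),
      (∀ i, 0 < b i) → Monotone b → b ⟨N - 1, by omega⟩ ≤ k →
      ∀ (X : Type*) [Fintype X] [DecidableEq X] (B : Fin n → Finset X),
        AvoiderEnforcer.IsBoxFamily b B →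
        ∀ first : AvoiderEnforcer.Player,
          AvoiderEnforcer.EnforcerHasWinningStrategy p q (Set.range B) first := by
  refine ⟨AvoiderEnforcer.sufficientCount q k, AvoiderEnforcer.sufficientCount_pos q k, ?_⟩
  intro n hn b _ hmono hbk X _ _ B hB first
  have hN := AvoiderEnforcer.sufficientCount_pos q k
  refine AvoiderEnforcer.ForcesWin.hasWinningStrategy
    (AvoiderEnforcer.suffices_sufficientCount hq hgcd hB.disjoint
      (Finset.univ.map (Fin.castLEEmb hn)) ∅ ∅ first (by simp) fun i hi => ?_)
  refine ⟨Finset.disjoint_empty_right _, ?_⟩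
  rw [Finset.sdiff_empty, hB.card_eq]
  obtain ⟨j, _, rfl⟩ := Finset.mem_map.1 hi
  -- The first `N` boxes are used; the largest has index `N - 1`.
  refine (hmono ?_).trans hbk
  have := j.isLt
  simp only [Fin.le_def, Fin.castLEEmb_apply, Fin.val_castLE]
  omega
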